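/- Let $\beta\in(0,1)$, $k\ge 1$, and $\lambda_1,\dots,\lambda_k>0$. Let $\{D(t)\}_{t\ge0}$ be a $\beta$-stable subordinator, i.e. a process with $D(0)=0$, stationary independent increments, nondecreasing right-continuous paths (a.s.) and $\mathbb E[e^{-uD(t)}]=e^{-tu^\beta}$ for $u>0$, and let $\mathcal W_\beta(t)=\inf\{r\ge 0: D(r)>t\}$ be its inverse. Let $\{\mathcal N(t)\}_{t\ge0}$ be a generalized counting process with rates $\lambda_1,\dots,\lambda_k$, i.e. an $\mathbb N_0$-valued process with $\mathcal N(0)=0$, nondecreasing right-continuous paths (a.s.) and independent stationary increments such that $$\Pr\{\mathcal N(s+h)-\mathcal N(s)=n\}=\sum_{\substack{x_1,\dots,x_k\in\mathbb N_0\\ x_1+2x_2+\cdots+kx_k=n}} e^{-(\lambda_1+\cdots+\lambda_k)h}\prod_{j=1}^k\frac{(\lambda_jh)^{x_j}}{x_j!},\qquad s,h\ge0,\ n\ge 0 .$$ Let $X_1,X_2,\dots$ be i.i.d. real random variables with mean $\eta>0$ and finite variance. Assume that the process $\mathcal N$, the process $D$ and the sequence $(X_j)_{j\ge1}$ are mutually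 independent. Put $\mathcal N^\beta(t)=\mathcal N(\mathcal W_\beta(t))$ and, for $\nu>0$ and $\rho\in\mathbb R$, define the generalized fractional risk process $$R^\beta(t)=\nu+\eta(1+\rho)\Big(\sum_{j=1}^k j\lambda_j\Big)\mathcal W_\beta(t)-\sum_{j=1}^{\mathcal N^\beta(t)}X_j,\qquad t\ge0 .$$ Set $$S=\frac{\sum_{j=1}^k j\lambda_j}{\Gamma(\beta+1)},\qquad T=\frac{\sum_{j=1}^k j^2\lambda_j}{\Gamma(\beta+1)} .$$ Theorem. For every $t\ge0$ the random variables $\mathcal W_\beta(t)$ and $R^\beta(t)$ are square integrable, and for all $0<s\le t$ $$\operatorname{Cov}[R^\beta(t),R^\beta(s)]=\eta^2\Big(\sum_{j=1}^k j\lambda_j\Big)^2\rho^2\,\operatorname{Cov}[\mathcal W_\beta(s),\mathcal W_\beta(t)]+S\,s^\beta\operatorname{Var}[X_1]+T\,s^\beta\eta^2 .$$ In particular, for every $t>0$, $$\operatorname{Var}[R^\beta(t)]=\eta^2\Big(\sum_{j=1}^k j\lambda_j\Big)^2\rho^2\,\operatorname{Var}[\mathcal W_\beta(t)]+S\,t^\beta\operatorname{Var}[X_1]+T\,t^\beta\eta^2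 .$$ -/

import Mathlib

open MeasureTheory ProbabilityTheory
open scoped NNReal

noncomputable section

/-- `D` is a `β`-stable subordinator under `μ`: it starts at `0`, has stationary independent
increments, nondecreasing right-continuous paths (so left limits exist automatically), and Laplace
transform `𝔼[exp (-u D(t))] = exp (-t u ^ β)`. -/
structure IsStableSubordinator {Ω : Type*} [MeasurableSpace Ω] (β : ℝ) (D : ℝ≥0 → Ω → ℝ)
    (μ : Measure Ω) : Prop where
  measurable : ∀ t, Measurable (D t)
  start_zero : ∀ᵐ ω ∂μ, D 0 ω = 0
  indep_increments : HasIndepIncrements D μ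
  stationary_increments : ∀ s t : ℝ≥0,
    IdentDistrib (fun ω => D (s + t) ω - D s ω) (D t) μ μ
  monotone_paths : ∀ᵐ ω ∂μ, Monotone (fun t => D t ω)
  rightCts_paths : ∀ᵐ ω ∂μ, ∀ t, ContinuousWithinAt (fun r => D r ω) (Set.Ici t) t
  laplace : ∀ (t : ℝ≥0) (u : ℝ), 0 < u →
    ∫ ω, Real.exp (-u * D t ω) ∂μ = Real.exp (-(t : ℝ) * u ^ β)

/-- The first passage time process `W(t) = inf {r ≥ 0 : D(r) > t}` of `D`. -/
def inverseSubordinator {Ω : Type*} (D : ℝ≥0 → Ω → ℝ) (t : ℝ≥0) (ω : Ω) : ℝ≥0 :=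
  sInf {r : ℝ≥0 | (t : ℝ) < D r ω}

/-- `∑_{j=1}^k j λ_j`; the rate `λ_j` of jumps of size `j` is `lam i` for `i : Fin k` with
`j = i + 1`. -/
def rateSum {k : ℕ} (lam : Fin k → ℝ) : ℝ := ∑ i : Fin k, ((i : ℝ) + 1) * lam i

/-- `∑_{j=1}^k j² λ_j`. -/
def rateSqSum {k : ℕ} (lam : Fin k → ℝ) : ℝ := ∑ i : Fin k, ((i : ℝ) + 1) ^ 2 * lam i

/-- The probability mass function of the generalized counting process,
`p_n(t) = ∑ exp (-(λ_1 + ⋯ + λ_k) t) ∏_j (λ_j t)^{x_j} / x_j!`, the sum being over all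
`(x_1, …, x_k) ∈ ℕ^k` with `x_1 + 2 x_2 + ⋯ + k x_k = n` (each such `x_j` is at most `n`). -/
def gcpPmf {k : ℕ} (lam : Fin k → ℝ) (t : ℝ≥0) (n : ℕ) : ℝ :=
  ∑ x ∈ (Fintype.piFinset fun _ : Fin k => Finset.range (n + 1)).filter
      (fun x => ∑ i : Fin k, ((i : ℕ) + 1) * x i = n),
    Real.exp (-(∑ i, lam i) * (t : ℝ)) *
      ∏ i, (lam i * (t : ℝ)) ^ x i / ((x i).factorial : ℝ)

/-- `N` is a generalized counting process under `μ`, with jumps of sizes `1, …, k` at rates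
`λ_1, …, λ_k`: a counting process started at `0` with independent stationary increments, the
increment over an interval of length `h` having mass function `gcpPmf lam h`. -/
structure IsGeneralizedCountingProcess {Ω : Type*} [MeasurableSpace Ω] {k : ℕ}
    (lam : Fin k → ℝ) (N : ℝ≥0 → Ω → ℕ) (μ : Measure Ω) : Prop where
  measurable : ∀ t, Measurable (N t)
  start_zero : ∀ᵐ ω ∂μ, N 0 ω = 0
  indep_increments : HasIndepIncrements (fun t ω => (N t ω : ℝ)) μ
  increment_law : ∀ (s h : ℝ≥0) (n : ℕ),
    μ.real {ω | N (s + h) ω = N s ω + n} = gcpPmf lam h n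
  monotone_paths : ∀ᵐ ω ∂μ, Monotone (fun t => N t ω)
  rightCts_paths : ∀ᵐ ω ∂μ, ∀ t, ContinuousWithinAt (fun r => N r ω) (Set.Ici t) t

/-- The generalized fractional counting process `N^β(t) = N(W_β(t))`, where `W_β` is the first
passage time process of the stable subordinator `D`. -/
def gfcp {Ω : Type*} (N : ℝ≥0 → Ω → ℕ) (D : ℝ≥0 → Ω → ℝ) (t : ℝ≥0) (ω : Ω) : ℕ :=
  N (inverseSubordinator D t ω) ω

/-- The generalized fractional risk process
`R^β(t) = ν + η (1 + ρ) (∑_j j λ_j) W_β(t) - ∑_{j=1}^{N^β(t)} X_j`.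
The claim `X_j` is `X (j - 1)`, so that the sum runs over `Finset.range (N^β(t))`. -/
def gfrp {Ω : Type*} {k : ℕ} (lam : Fin k → ℝ) (ν η ρ : ℝ) (N : ℝ≥0 → Ω → ℕ)
    (D : ℝ≥0 → Ω → ℝ) (X : ℕ → Ω → ℝ) (t : ℝ≥0) (ω : Ω) : ℝ :=
  ν + η * (1 + ρ) * rateSum lam * (inverseSubordinator D t ω : ℝ)
    - ∑ j ∈ Finset.range (gfcp N D t ω), X j ω

/-- The constant `S = (∑_j j λ_j) / Γ(β + 1)`. -/
def gfcpS {k : ℕ} (β : ℝ) (lam : Fin k → ℝ) : ℝ := rateSum lam / Real.Gamma (β + 1)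

/-- The constant `T = (∑_j j² λ_j) / Γ(β + 1)`. -/
def gfcpT {k : ℕ} (β : ℝ) (lam : Fin k → ℝ) : ℝ := rateSqSum lam / Real.Gamma (β + 1)

end

/-! Put `Λ = rateSum lam`, `c = ηΛ`, `W = W_β`, and let `Z(r) = ∑_{j < N(r)} X_j - c r` be the
compensated claims. The premium splits so that `R(t) = ν + cρ W(t) - Z(W(t))`. The pair `(X, N)` is
independent of `D`, hence of `W`, and `Z(r)` is centred for each fixed `r`. Conditioning on `(W(s),
W(t))` therefore kills the cross covariances between `W` and `Z(W)`, and leaves `c²ρ² Cov[W(s),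
W(t)] + E[Z(W(s)) Z(W(t))]`.

For fixed `a ≤ b`, `E[Z(a) Z(b)] = (Var[X] Λ + η² ∑ j² λ_j) a` (`integral_compensatedClaims_mul`).
As `W(s) ≤ W(t)` almost surely, the last term is this constant times `E[W(s)]`.

The mean `E[W(s)]` is the mass that the potential measure `∫ P(D(r) ∈ ·) dr` gives to `[0, s]`. Its
Laplace transform is `∫ exp(-r u^β) dr = u^(-β)`, which is that of `x^(β-1)/Γ(β) dx`; uniqueness
gives `E[W(s)] = s^β/Γ(β+1)`. Square integrability of `W` comes from `P(W(t) > x) ≤ P(D(x) ≤ t) ≤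
exp(t - x)`.

Conditioning is Fubini on path space, which requires `W` and `N(W)` to be almost surely measurable
functions of paths: hence `rationalPassageTime` and `pathEval`. -/

/-! ### Uniqueness of Laplace transforms on the half-line. -/

/-- The bounded continuous function `x ↦ exp (-x)` on `[0, ∞)`. -/
noncomputable def expNegBCF : BoundedContinuousFunction ℝ≥0 ℝ :=
  BoundedContinuousFunction.ofNormedAddCommGroup (fun x : ℝ≥0 => Real.exp (-(x : ℝ)))
    (by fun_prop) 1 (fun x => by
      rw [Real.norm_eq_abs, Real.abs_exp]
      exact Real.exp_le_one_iff.2 (by simp))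

theorem expNegBCF_apply (x : ℝ≥0) : expNegBCF x = Real.exp (-(x : ℝ)) := rfl

/-- Finite measures on `[0, ∞)` are determined by their Laplace transforms at the integers. -/
theorem ext_of_integral_exp_neg_nat_eq {μ ν : Measure ℝ≥0} [IsFiniteMeasure μ] [IsFiniteMeasure ν]
    (h : ∀ n : ℕ, ∫ x, Real.exp (-(n * (x : ℝ))) ∂μ = ∫ x, Real.exp (-(n * (x : ℝ))) ∂ν) :
    μ = ν := by
  -- Polynomials in `exp(-x)` separate points, and their integrals are combinations of the
  -- transforms at integers.
  let A : StarSubalgebra ℝ (BoundedContinuousFunction ℝ≥0 ℝ) :=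
    { Algebra.adjoin ℝ {expNegBCF} with
      star_mem' := fun {a} ha => by
        have : star a = a := by ext x; simp
        rw [this]; exact ha }
  refine ext_of_forall_mem_subalgebra_integral_eq_of_polish (A := A) ?_ ?_
  · intro x y hxy
    refine ⟨_, ⟨_, ⟨expNegBCF, Algebra.subset_adjoin rfl, rfl⟩, rfl⟩, ?_⟩
    change Real.exp (-(x : ℝ)) ≠ Real.exp (-(y : ℝ))
    simpa using hxy
  · intro g hg
    have hg : g ∈ Algebra.adjoin ℝ {expNegBCF} := hg
    rw [Algebra.adjoin_singleton_eq_range_aeval] at hg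
    obtain ⟨p, rfl⟩ := hg
    have key : ∀ x : ℝ≥0, (Polynomial.aeval expNegBCF p) x
        = ∑ i ∈ Finset.range (p.natDegree + 1), p.coeff i * Real.exp (-(i * (x : ℝ))) := by
      intro x
      rw [Polynomial.aeval_eq_sum_range, BoundedContinuousFunction.coe_sum, Finset.sum_apply]
      refine Finset.sum_congr rfl fun i _ => ?_
      simp [expNegBCF_apply, ← Real.exp_nat_mul]
    have hint : ∀ (ρ : Measure ℝ≥0) [IsFiniteMeasure ρ] (i : ℕ),
        Integrable (fun x : ℝ≥0 => p.coeff i * Real.exp (-(i * (x : ℝ)))) ρ := by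
      intro ρ _ i
      refine Integrable.const_mul ?_ _
      refine Integrable.of_bound (by fun_prop) 1 (.of_forall fun x => ?_)
      rw [Real.norm_eq_abs, Real.abs_exp]
      exact Real.exp_le_one_iff.2 (by simp; positivity)
    change ∫ x, (Polynomial.aeval expNegBCF p) x ∂μ = ∫ x, (Polynomial.aeval expNegBCF p) x ∂ν
    simp_rw [key]
    rw [integral_finsetSum _ fun i _ => hint μ i, integral_finsetSum _ fun i _ => hint ν i]
    simp_rw [integral_const_mul, h]

/-- Measures on `[0, ∞)` are determined by their Laplace transforms at the positive integers, if
these are finite. -/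
theorem ext_of_lintegral_exp_neg_nat_eq {μ ν : Measure ℝ≥0}
    (h : ∀ n : ℕ, 0 < n → ∫⁻ x, ENNReal.ofReal (Real.exp (-(n * (x : ℝ)))) ∂μ
      = ∫⁻ x, ENNReal.ofReal (Real.exp (-(n * (x : ℝ)))) ∂ν)
    (hfin : ∫⁻ x, ENNReal.ofReal (Real.exp (-(x : ℝ))) ∂μ ≠ ⊤) : μ = ν := by
  -- Tilting by `exp(-x)` makes both measures finite and shifts the transform from `n + 1` to `n`.
  -- The density is never `0` or `⊤`, so the tilt can be undone.
  set f : ℝ≥0 → ENNReal := fun x => ENNReal.ofReal (Real.exp (-(x : ℝ))) with hf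
  have hfm : Measurable f := by fun_prop
  have hf0 : ∀ x, f x ≠ 0 := fun x => by simp [hf, Real.exp_pos]
  have hft : ∀ x, f x ≠ ⊤ := fun x => by simp [hf]
  have hfin' : ∫⁻ x, f x ∂ν ≠ ⊤ := by
    have := h 1 one_pos
    simp only [Nat.cast_one, one_mul] at this
    rwa [← this]
  have : IsFiniteMeasure (μ.withDensity f) := isFiniteMeasure_withDensity hfin
  have : IsFiniteMeasure (ν.withDensity f) := isFiniteMeasure_withDensity hfin'
  have hlap : ∀ (ρ : Measure ℝ≥0) (n : ℕ), ∫ x, Real.exp (-(n * (x : ℝ))) ∂(ρ.withDensity f)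
      = (∫⁻ x, ENNReal.ofReal (Real.exp (-((n + 1 : ℕ) * (x : ℝ)))) ∂ρ).toReal := by
    intro ρ n
    rw [integral_eq_lintegral_of_nonneg_ae (.of_forall fun _ => (Real.exp_pos _).le) (by fun_prop),
      lintegral_withDensity_eq_lintegral_mul _ hfm (by fun_prop)]
    congr 1
    refine lintegral_congr fun x => ?_
    rw [Pi.mul_apply, hf, ← ENNReal.ofReal_mul (Real.exp_pos _).le, ← Real.exp_add]
    congr 2
    push_cast; ring
  have key : μ.withDensity f = ν.withDensity f := by
    refine ext_of_integral_exp_neg_nat_eq fun n => ?_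
    rw [hlap, hlap, h _ n.succ_pos]
  rw [← withDensity_inv_same (μ := μ) hfm (.of_forall hf0) (.of_forall hft),
    ← withDensity_inv_same (μ := ν) hfm (.of_forall hf0) (.of_forall hft), key]

/-! ### The candidate for the potential measure. -/

/-- The measure `x ^ (β - 1) / Γ(β) dx` on `[0, ∞)`. -/
noncomputable def powerMeasure (β : ℝ) : Measure ℝ≥0 :=
  ((volume.restrict (Set.Ioi (0 : ℝ))).withDensity
    fun x => ENNReal.ofReal (x ^ (β - 1) / Real.Gamma β)).map Real.toNNReal

theorem lintegral_exp_neg_powerMeasure {β : ℝ} (hβ : 0 < β) {u : ℝ} (hu : 0 < u) :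
    ∫⁻ x, ENNReal.ofReal (Real.exp (-(u * (x : ℝ)))) ∂powerMeasure β
      = ENNReal.ofReal ((u ^ β)⁻¹) := by
  have hG := Real.Gamma_pos_of_pos hβ
  have hI := Real.integral_rpow_mul_exp_neg_mul_Ioi hβ hu
  have hint : IntegrableOn (fun t : ℝ => t ^ (β - 1) * Real.exp (-(u * t))) (Set.Ioi 0) := by
    -- The Bochner integral of a non-integrable function is `0`, so a nonzero value proves
    -- integrability.
    refine Integrable.of_integral_ne_zero ?_
    rw [hI]; positivity
  rw [powerMeasure, lintegral_map (by fun_prop) (by fun_prop),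
    lintegral_withDensity_eq_lintegral_mul _ (by fun_prop) (by fun_prop)]
  calc _ = ∫⁻ x in Set.Ioi (0 : ℝ), ENNReal.ofReal
        ((Real.Gamma β)⁻¹ * (x ^ (β - 1) * Real.exp (-(u * x)))) := by
        refine setLIntegral_congr_fun measurableSet_Ioi fun x hx => ?_
        have hx : 0 < x := hx
        rw [Pi.mul_apply, ← ENNReal.ofReal_mul (by positivity), Real.coe_toNNReal _ hx.le]
        congr 1; ring
    _ = _ := by
        rw [← ofReal_integral_eq_lintegral_ofReal (hint.const_mul _), integral_const_mul, hI]
        · congr 1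
          rw [one_div, Real.inv_rpow hu.le]
          field_simp
        · refine (ae_restrict_iff' measurableSet_Ioi).2 (.of_forall fun x hx => ?_)
          have hx : 0 < x := hx
          simp only [Pi.zero_apply]; positivity

theorem powerMeasure_Iic {β : ℝ} (hβ : 0 < β) (s : ℝ≥0) :
    powerMeasure β (Set.Iic s) = ENNReal.ofReal ((s : ℝ) ^ β / Real.Gamma (β + 1)) := by
  have hG := Real.Gamma_pos_of_pos hβ
  rw [powerMeasure, Measure.map_apply (by fun_prop) measurableSet_Iic, withDensity_apply _
    (measurableSet_Iic.preimage (by fun_prop)), Measure.restrict_restrict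
    (measurableSet_Iic.preimage (by fun_prop))]
  have hset : Real.toNNReal ⁻¹' Set.Iic s ∩ Set.Ioi 0 = Set.Ioc 0 (s : ℝ) := by
    ext x; simp [Real.toNNReal_le_iff_le_coe, and_comm]
  have hint := intervalIntegral.intervalIntegrable_rpow' (a := 0) (b := (s : ℝ))
    (r := β - 1) (by linarith)
  have hint := (intervalIntegrable_iff_integrableOn_Ioc_of_le s.coe_nonneg).1 hint
  rw [hset, ← ofReal_integral_eq_lintegral_ofReal (hint.div_const _),
    integral_div, ← intervalIntegral.integral_of_le s.coe_nonneg, integral_rpow (.inl (by linarith))]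
  · congr 1
    rw [Real.Gamma_add_one hβ.ne', sub_add_cancel, Real.zero_rpow hβ.ne']
    field_simp; simp
  · refine (ae_restrict_iff' measurableSet_Ioc).2 (.of_forall fun x hx => ?_)
    have hx : 0 < x := hx.1
    simp only [Pi.zero_apply]; positivity

/-! ### Pathwise properties and measurability of the first passage time. -/

theorem lt_of_lt_inverseSubordinator {Ω : Type*} {D : ℝ≥0 → Ω → ℝ} {t r : ℝ≥0} {ω : Ω}
    (h : r < inverseSubordinator D t ω) : D r ω ≤ t :=
  not_lt.1 fun h' => notMem_of_lt_csInf (s := {r : ℝ≥0 | (t : ℝ) < D r ω}) h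
    (OrderBot.bddBelow _) h'

/-- Unboundedness is needed because `sInf ∅ = 0` would make the passage time vanish on a path that
never exceeds `t`. -/
theorem le_inverseSubordinator {Ω : Type*} {D : ℝ≥0 → Ω → ℝ} {t r : ℝ≥0} {ω : Ω}
    (hmono : Monotone fun t => D t ω) (hunb : ∃ q, (t : ℝ) < D q ω) (h : D r ω ≤ t) :
    r ≤ inverseSubordinator D t ω :=
  le_csInf hunb fun q hq => by
    by_contra hlt
    exact absurd (hmono (not_le.1 hlt).le) (not_le.2 (lt_of_le_of_lt h hq))

theorem inverseSubordinator_mono {Ω : Type*} {D : ℝ≥0 → Ω → ℝ} {s t : ℝ≥0} {ω : Ω}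
    (hunb : ∃ q, (t : ℝ) < D q ω) (h : s ≤ t) :
    inverseSubordinator D s ω ≤ inverseSubordinator D t ω :=
  csInf_le_csInf (OrderBot.bddBelow _) hunb fun _ hq => lt_of_le_of_lt (NNReal.coe_le_coe.2 h) hq

theorem measure_lt_inverseSubordinator_le {Ω : Type*} [MeasurableSpace Ω] (μ : Measure Ω) (D : ℝ≥0 → Ω → ℝ) (t : ℝ≥0) {x : ℝ}
    (hx : 0 ≤ x) : μ {ω | x < (inverseSubordinator D t ω : ℝ)} ≤ μ {ω | D x.toNNReal ω ≤ t} := by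
  refine measure_mono fun ω hω => ?_
  refine lt_of_lt_inverseSubordinator ?_
  rwa [← NNReal.coe_lt_coe, Real.coe_toNNReal _ hx]

/-- The first passage time over the level `t` of the path `d`, with the passage observed at
rational times only. -/
noncomputable def rationalPassageTime (t : ℝ≥0) (d : ℝ≥0 → ℝ) : ℝ≥0 :=
  (⨅ q : ℚ≥0, if (t : ℝ) < d (q : ℝ≥0) then ((q : ℝ≥0) : ENNReal) else ⊤).toNNReal

theorem measurable_rationalPassageTime (t : ℝ≥0) : Measurable (rationalPassageTime t) := by
  refine ENNReal.measurable_toNNReal.comp (Measurable.iInf fun q => ?_)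
  exact Measurable.ite (measurableSet_lt measurable_const (measurable_pi_apply _))
    measurable_const measurable_const

/-- On a monotone path, exceeding `t` at `r` forces it at every later rational. If the level is
never passed, both sides take the default value `0`. -/
theorem inverseSubordinator_eq_rationalPassageTime {Ω : Type*} {D : ℝ≥0 → Ω → ℝ} {ω : Ω}
    (hmono : Monotone fun t => D t ω) (t : ℝ≥0) :
    inverseSubordinator D t ω = rationalPassageTime t (fun r => D r ω) := by
  by_cases hunb : ∃ q, (t : ℝ) < D q ω
  · have : (⨅ q : ℚ≥0, if (t : ℝ) < D (q : ℝ≥0) ω then ((q : ℝ≥0) : ENNReal) else ⊤)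
        = (inverseSubordinator D t ω : ENNReal) := by
      refine le_antisymm (ENNReal.le_of_forall_pos_le_add fun ε hε _ => ?_) (le_iInf fun q => ?_)
      · obtain ⟨r, hr, hrlt⟩ := exists_lt_of_csInf_lt (s := {r : ℝ≥0 | (t : ℝ) < D r ω}) hunb
          (show sInf {r : ℝ≥0 | (t : ℝ) < D r ω} < inverseSubordinator D t ω + ε from
            lt_add_of_pos_right _ hε)
        obtain ⟨q, hq1, hq2⟩ := exists_rat_btwn (NNReal.coe_lt_coe.2 hrlt)
        have hq0 : 0 ≤ q := by
          have := r.coe_nonneg.trans hq1.le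
          exact_mod_cast this
        lift q to ℚ≥0 using hq0
        have hq1 : r < (q : ℝ≥0) := by exact_mod_cast hq1
        have hq2 : (q : ℝ≥0) < inverseSubordinator D t ω + ε := by exact_mod_cast hq2
        refine (iInf_le _ q).trans ?_
        rw [if_pos (lt_of_lt_of_le hr (hmono hq1.le))]
        exact_mod_cast hq2.le
      · split_ifs with h
        · exact ENNReal.coe_le_coe.2 (csInf_le (OrderBot.bddBelow _) h)
        · exact le_top
    rw [rationalPassageTime, this, ENNReal.toNNReal_coe]
  · push Not at hunb
    have h1 : {r : ℝ≥0 | (t : ℝ) < D r ω} = ∅ := by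
      ext r; simpa using hunb r
    rw [inverseSubordinator, h1, rationalPassageTime]
    simp [not_lt.2 (hunb _)]

/-! ### Moments of the inverse stable subordinator. -/

namespace IsStableSubordinator

variable {Ω : Type*} [MeasurableSpace Ω] {μ : Measure Ω} {β : ℝ}
  {D : ℝ≥0 → Ω → ℝ}

theorem ae_nonneg (hD : IsStableSubordinator β D μ) (t : ℝ≥0) : ∀ᵐ ω ∂μ, 0 ≤ D t ω := by
  filter_upwards [hD.start_zero, hD.monotone_paths] with ω h0 hm
  rw [← h0]; exact hm zero_le

theorem integrable_exp_neg (hD : IsStableSubordinator β D μ) (t : ℝ≥0) {u : ℝ} (hu : 0 < u) :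
    Integrable (fun ω => Real.exp (-u * D t ω)) μ := by
  refine Integrable.of_integral_ne_zero ?_
  rw [hD.laplace t u hu]; exact (Real.exp_pos _).ne'

theorem lintegral_exp_neg (hD : IsStableSubordinator β D μ) (t : ℝ≥0) {u : ℝ} (hu : 0 < u) :
    ∫⁻ ω, ENNReal.ofReal (Real.exp (-u * D t ω)) ∂μ
      = ENNReal.ofReal (Real.exp (-(t : ℝ) * u ^ β)) := by
  rw [← hD.laplace t u hu, ofReal_integral_eq_lintegral_ofReal (hD.integrable_exp_neg t hu)
    (.of_forall fun _ => (Real.exp_pos _).le)]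

/-- Markov's inequality for `exp(-D(r))`, at `u = 1` where `u ^ β = 1`. It yields both unbounded
paths and exponential tails of the inverse. -/
theorem measure_le_le [IsProbabilityMeasure μ] (hD : IsStableSubordinator β D μ) (s r : ℝ≥0) :
    μ {ω | D r ω ≤ s} ≤ ENNReal.ofReal (Real.exp s * Real.exp (-(r : ℝ))) := by
  have h := mul_meas_ge_le_lintegral₀ (μ := μ)
    (f := fun ω => ENNReal.ofReal (Real.exp (-1 * D r ω)))
    (by have := hD.measurable r; fun_prop) (ENNReal.ofReal (Real.exp (-(s : ℝ))))
  rw [hD.lintegral_exp_neg r one_pos, Real.one_rpow, mul_one] at h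
  have hset : {ω | ENNReal.ofReal (Real.exp (-(s : ℝ))) ≤ ENNReal.ofReal (Real.exp (-1 * D r ω))}
      = {ω | D r ω ≤ s} := by
    ext ω
    simp [ENNReal.ofReal_le_ofReal_iff (Real.exp_pos _).le]
  rw [hset] at h
  calc μ {ω | D r ω ≤ s}
      = ENNReal.ofReal (Real.exp s) * (ENNReal.ofReal (Real.exp (-(s : ℝ))) * μ {ω | D r ω ≤ s}) := by
        rw [← mul_assoc, ← ENNReal.ofReal_mul (Real.exp_pos _).le, ← Real.exp_add]; simp
    _ ≤ _ := by
        rw [ENNReal.ofReal_mul (Real.exp_pos _).le]; gcongr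

theorem ae_unbounded [IsProbabilityMeasure μ] (hD : IsStableSubordinator β D μ) (s : ℝ≥0) :
    ∀ᵐ ω ∂μ, ∃ r, (s : ℝ) < D r ω := by
  rw [ae_iff]
  push Not
  have hlim : Filter.Tendsto (fun n : ℕ => ENNReal.ofReal (Real.exp s * Real.exp (-(n : ℝ))))
      Filter.atTop (nhds 0) := by
    rw [← ENNReal.ofReal_zero]
    refine ENNReal.tendsto_ofReal ?_
    rw [← mul_zero (Real.exp s)]
    exact (Real.tendsto_exp_neg_atTop_nhds_zero.comp tendsto_natCast_atTop_atTop).const_mul _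
  refine le_antisymm (ge_of_tendsto' hlim fun n => ?_) zero_le
  refine (measure_mono fun ω hω => ?_).trans (by simpa using hD.measure_le_le s (n : ℝ≥0))
  exact hω n

theorem aemeasurable_inverseSubordinator (hD : IsStableSubordinator β D μ) (t : ℝ≥0) :
    AEMeasurable (inverseSubordinator D t) μ := by
  refine ⟨fun ω => rationalPassageTime t (fun r => D r ω),
    (measurable_rationalPassageTime t).comp (measurable_pi_lambda _ hD.measurable), ?_⟩
  filter_upwards [hD.monotone_paths] with ω hm
  exact inverseSubordinator_eq_rationalPassageTime hm t

theorem measure_le_le_inverseSubordinator [IsProbabilityMeasure μ] (hD : IsStableSubordinator β D μ) (t : ℝ≥0) {x : ℝ}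
    (hx : 0 ≤ x) : μ {ω | D x.toNNReal ω ≤ t} ≤ μ {ω | x ≤ (inverseSubordinator D t ω : ℝ)} := by
  refine measure_mono_ae ?_
  filter_upwards [hD.monotone_paths, hD.ae_unbounded t] with ω hm hu (hω : D x.toNNReal ω ≤ t)
  have := le_inverseSubordinator hm hu hω
  rwa [← NNReal.coe_le_coe, Real.coe_toNNReal _ hx] at this

/-- Layer cake: up to null sets `{D(x) ≤ t}` lies between `{W > x}` and `{W ≥ x}`, whose measures
agree for almost every `x`. -/
theorem lintegral_inverseSubordinator [IsProbabilityMeasure μ] (hD : IsStableSubordinator β D μ) (t : ℝ≥0) :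
    ∫⁻ ω, ENNReal.ofReal (inverseSubordinator D t ω : ℝ) ∂μ
      = ∫⁻ x in Set.Ioi (0 : ℝ), μ {ω | D x.toNNReal ω ≤ t} := by
  have hm := (hD.aemeasurable_inverseSubordinator t).coe_nnreal_real
  rw [lintegral_eq_lintegral_meas_lt μ (.of_forall fun _ => NNReal.coe_nonneg _) hm]
  refine lintegral_congr_ae ?_
  filter_upwards [meas_le_ae_eq_meas_lt μ (volume.restrict (Set.Ioi (0 : ℝ)))
    (fun ω => (inverseSubordinator D t ω : ℝ)), ae_restrict_mem measurableSet_Ioi] with x hx hx0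
  have hx0 : 0 ≤ x := le_of_lt hx0
  refine le_antisymm (measure_lt_inverseSubordinator_le μ D t hx0) ?_
  rw [← hx]
  exact hD.measure_le_le_inverseSubordinator t hx0

/-- The potential measure `∫ P(D(r) ∈ ·) dr` of `D`. -/
noncomputable def _root_.potentialMeasure (D : ℝ≥0 → Ω → ℝ) (μ : Measure Ω) : Measure ℝ≥0 :=
  (volume.restrict (Set.Ioi (0 : ℝ))).bind
    fun x => μ.map fun ω => (D x.toNNReal ω).toNNReal

/-- Needed for `bind` to compute the potential measure. Half-lines suffice as a π-system, and by
monotone paths `x ↦ P(D(x) ≤ a)` is antitone. -/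
theorem measurable_law [IsProbabilityMeasure μ] (hD : IsStableSubordinator β D μ) :
    Measurable fun x : ℝ => μ.map fun ω => (D x.toNNReal ω).toNNReal := by
  have hmeas : ∀ x : ℝ, Measurable fun ω => (D x.toNNReal ω).toNNReal :=
    fun x => (hD.measurable _).real_toNNReal
  have (x : ℝ) : IsProbabilityMeasure (μ.map fun ω => (D x.toNNReal ω).toNNReal) :=
    Measure.isProbabilityMeasure_map (hmeas x).aemeasurable
  refine .measure_of_isPiSystem_of_isProbabilityMeasure (borel_eq_generateFrom_Iic ℝ≥0 ▸
    BorelSpace.measurable_eq) isPiSystem_Iic ?_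
  rintro _ ⟨a, rfl⟩
  refine Antitone.measurable fun x y hxy => ?_
  simp only [Measure.map_apply (hmeas _) measurableSet_Iic]
  refine measure_mono_ae ?_
  filter_upwards [hD.monotone_paths] with ω hm (hω : _ ≤ a)
  exact (Real.toNNReal_mono (hm (Real.toNNReal_mono hxy))).trans hω

theorem potentialMeasure_Iic [IsProbabilityMeasure μ] (hD : IsStableSubordinator β D μ) (t : ℝ≥0) :
    potentialMeasure D μ (Set.Iic t) = ∫⁻ x in Set.Ioi (0 : ℝ), μ {ω | D x.toNNReal ω ≤ t} := by
  rw [potentialMeasure, Measure.bind_apply measurableSet_Iic hD.measurable_law.aemeasurable]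
  refine lintegral_congr fun x => ?_
  rw [Measure.map_apply (hD.measurable _).real_toNNReal measurableSet_Iic]
  congr 1
  ext ω
  simp [Real.toNNReal_le_iff_le_coe]

theorem lintegral_exp_neg_potentialMeasure [IsProbabilityMeasure μ] (hD : IsStableSubordinator β D μ) {u : ℝ}
    (hu : 0 < u) :
    ∫⁻ x, ENNReal.ofReal (Real.exp (-(u * (x : ℝ)))) ∂potentialMeasure D μ
      = ENNReal.ofReal ((u ^ β)⁻¹) := by
  rw [potentialMeasure, Measure.lintegral_bind hD.measurable_law.aemeasurable (by fun_prop)]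
  have hpos : 0 < u ^ β := by positivity
  calc _ = ∫⁻ x in Set.Ioi (0 : ℝ), ENNReal.ofReal (Real.exp (-(u ^ β) * x)) := by
        refine setLIntegral_congr_fun measurableSet_Ioi fun x hx => ?_
        have hx : 0 ≤ x := le_of_lt hx
        rw [lintegral_map (by fun_prop) (hD.measurable _).real_toNNReal]
        have := hD.lintegral_exp_neg x.toNNReal hu
        rw [Real.coe_toNNReal _ hx] at this
        rw [show -(u ^ β) * x = -x * u ^ β by ring, ← this]
        refine lintegral_congr_ae ?_
        filter_upwards [hD.ae_nonneg x.toNNReal] with ω hω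
        rw [Real.coe_toNNReal _ hω, neg_mul]
    _ = _ := by
        rw [← ofReal_integral_eq_lintegral_ofReal
          (integrableOn_exp_mul_Ioi (neg_lt_zero.2 hpos) 0)
          (.of_forall fun _ => (Real.exp_pos _).le), integral_exp_mul_Ioi (neg_lt_zero.2 hpos)]
        congr 1
        simp

theorem potentialMeasure_eq_powerMeasure [IsProbabilityMeasure μ] (hD : IsStableSubordinator β D μ) (hβ : 0 < β) :
    potentialMeasure D μ = powerMeasure β := by
  refine ext_of_lintegral_exp_neg_nat_eq (fun n hn => ?_) ?_
  · rw [hD.lintegral_exp_neg_potentialMeasure (Nat.cast_pos.2 hn),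
      lintegral_exp_neg_powerMeasure hβ (Nat.cast_pos.2 hn)]
  · have := hD.lintegral_exp_neg_potentialMeasure one_pos
    simp only [one_mul] at this
    rw [this]; simp

/-- The mean of the inverse stable subordinator. -/
theorem integral_inverseSubordinator [IsProbabilityMeasure μ] (hD : IsStableSubordinator β D μ) (hβ : 0 < β) (t : ℝ≥0) :
    ∫ ω, (inverseSubordinator D t ω : ℝ) ∂μ = (t : ℝ) ^ β / Real.Gamma (β + 1) := by
  rw [integral_eq_lintegral_of_nonneg_ae (.of_forall fun _ => NNReal.coe_nonneg _)
    (hD.aemeasurable_inverseSubordinator t).coe_nnreal_real.aestronglyMeasurable,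
    hD.lintegral_inverseSubordinator, ← hD.potentialMeasure_Iic,
    hD.potentialMeasure_eq_powerMeasure hβ, powerMeasure_Iic hβ, ENNReal.toReal_ofReal]
  have := Real.Gamma_pos_of_pos (show 0 < β + 1 by linarith)
  positivity

/-- `E[W²] = 2 ∫ x P(W > x) dx ≤ 2 exp(t) ∫ x exp(-x) dx`. -/
theorem memLp_inverseSubordinator [IsProbabilityMeasure μ] (hD : IsStableSubordinator β D μ) (t : ℝ≥0) :
    MemLp (fun ω => (inverseSubordinator D t ω : ℝ)) 2 μ := by
  have hm := (hD.aemeasurable_inverseSubordinator t).coe_nnreal_real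
  rw [memLp_two_iff_integrable_sq hm.aestronglyMeasurable]
  refine ⟨(hm.pow_const 2).aestronglyMeasurable, ?_⟩
  rw [hasFiniteIntegral_iff_ofReal (.of_forall fun _ => sq_nonneg _)]
  have h := lintegral_rpow_eq_lintegral_meas_lt_mul μ (f := fun ω => (inverseSubordinator D t ω : ℝ))
    (.of_forall fun _ => NNReal.coe_nonneg _) hm (p := 2) two_pos
  simp only [Real.rpow_two] at h
  rw [h]
  refine ENNReal.mul_lt_top (by simp) ?_
  have hI := Real.integral_rpow_mul_exp_neg_mul_Ioi (a := 2) (r := 1) two_pos one_pos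
  have hint : IntegrableOn (fun x : ℝ => x ^ ((2 : ℝ) - 1) * Real.exp (-(1 * x))) (Set.Ioi 0) := by
    refine Integrable.of_integral_ne_zero ?_
    rw [hI]; simp
  refine lt_of_le_of_lt ?_ (hint.const_mul (Real.exp t)).lintegral_lt_top
  refine setLIntegral_mono' measurableSet_Ioi fun x hx => ?_
  have hx : 0 < x := hx
  calc _ ≤ ENNReal.ofReal (Real.exp t * Real.exp (-x)) * ENNReal.ofReal (x ^ ((2 : ℝ) - 1)) := by
        gcongr
        refine (measure_lt_inverseSubordinator_le μ D t hx.le).trans ?_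
        simpa [hx.le] using hD.measure_le_le t x.toNNReal
    _ = _ := by
        rw [← ENNReal.ofReal_mul (by positivity)]
        congr 1; ring_nf

end IsStableSubordinator

/-! ### Poisson moments. -/

theorem hasSum_mul_poisson (r : ℝ) :
    HasSum (fun n : ℕ => Real.exp (-r) * r ^ n / n.factorial * n) r := by
  rw [← hasSum_nat_add_iff' 1]
  have h := ((NormedSpace.expSeries_div_hasSum_exp (r : ℝ)).mul_left (Real.exp (-r))).mul_left r
  rw [← Real.exp_eq_exp_ℝ, ← Real.exp_add] at h
  simp only [neg_add_cancel, Real.exp_zero, mul_one] at h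
  convert! h using 1
  · ext n
    rw [Nat.factorial_succ]; push_cast; field_simp; ring
  · simp

theorem hasSum_sq_mul_poisson (r : ℝ) :
    HasSum (fun n : ℕ => Real.exp (-r) * r ^ n / n.factorial * (n : ℝ) ^ 2) (r ^ 2 + r) := by
  rw [← hasSum_nat_add_iff' 1]
  have h := ((NormedSpace.expSeries_div_hasSum_exp (r : ℝ)).mul_left (Real.exp (-r))).mul_left r
  rw [← Real.exp_eq_exp_ℝ, ← Real.exp_add] at h
  simp only [neg_add_cancel, Real.exp_zero, mul_one] at h
  have h' := ((hasSum_mul_poisson r).mul_left r).add h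
  convert! h' using 1
  · ext n
    rw [Nat.factorial_succ]; push_cast; field_simp; ring
  · simp; ring

theorem memLp_natCast_poissonMeasure (r : ℝ≥0) :
    MemLp (fun n : ℕ => (n : ℝ)) 2 (poissonMeasure r) := by
  rw [memLp_two_iff_integrable_sq (by fun_prop), integrable_poissonMeasure_iff]
  simpa using (hasSum_sq_mul_poisson r).summable

theorem integral_natCast_poissonMeasure (r : ℝ≥0) : ∫ n, (n : ℝ) ∂poissonMeasure r = r := by
  rw [integral_poissonMeasure]
  exact (hasSum_mul_poisson r).tsum_eq

theorem variance_natCast_poissonMeasure (r : ℝ≥0) :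
    variance (fun n : ℕ => (n : ℝ)) (poissonMeasure r) = r := by
  rw [variance_eq_sub (memLp_natCast_poissonMeasure r), integral_natCast_poissonMeasure]
  simp only [Pi.pow_apply]
  rw [integral_poissonMeasure]
  simp only [smul_eq_mul]
  rw [(hasSum_sq_mul_poisson r).tsum_eq]; ring

/-! ### The increment law as a weighted sum of independent Poisson variables. -/

section jumpLaw

variable {k : ℕ}

/-- The joint law of the numbers of jumps of sizes `1, …, k` during an interval of length `h`. -/
noncomputable def jumpCountLaw (lam : Fin k → ℝ) (h : ℝ≥0) : Measure (Fin k → ℕ) :=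
  Measure.pi fun i => poissonMeasure ((lam i).toNNReal * h)

instance (lam : Fin k → ℝ) (h : ℝ≥0) : IsProbabilityMeasure (jumpCountLaw lam h) :=
  inferInstanceAs (IsProbabilityMeasure (Measure.pi _))

/-- The total displacement caused by `x i` jumps of size `i + 1`. -/
def totalJump (x : Fin k → ℕ) : ℕ := ∑ i : Fin k, ((i : ℕ) + 1) * x i

/-- This replaces the explicit mass function by a product measure, from which mean and variance
follow by linearity and independence. -/
theorem jumpCountLaw_totalJump (lam : Fin k → ℝ) (hlam : ∀ i, 0 ≤ lam i) (h : ℝ≥0) (n : ℕ) :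
    (jumpCountLaw lam h).real {x | totalJump x = n} = gcpPmf lam h n := by
  have hset : {x : Fin k → ℕ | totalJump x = n} =
      ↑((Fintype.piFinset fun _ : Fin k => Finset.range (n + 1)).filter
        (fun x => ∑ i : Fin k, ((i : ℕ) + 1) * x i = n)) := by
    ext x
    simp only [Set.mem_ofPred_eq, Finset.coe_filter, Fintype.mem_piFinset, Finset.mem_range]
    refine ⟨fun hx => ⟨fun i => ?_, hx⟩, fun hx => hx.2⟩
    have h1 : ((i : ℕ) + 1) * x i ≤ totalJump x :=
      Finset.single_le_sum (f := fun i : Fin k => ((i : ℕ) + 1) * x i)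
        (fun _ _ => Nat.zero_le _) (Finset.mem_univ i)
    rw [hx] at h1
    nlinarith [Nat.zero_le ((i : ℕ) * x i)]
  rw [hset, ← sum_measureReal_singleton, gcpPmf]
  refine Finset.sum_congr rfl fun x _ => ?_
  rw [measureReal_def, jumpCountLaw, Measure.pi_singleton, ENNReal.toReal_prod]
  have : ∀ i, (poissonMeasure ((lam i).toNNReal * h) {x i}).toReal
      = Real.exp (-(lam i * h)) * ((lam i * (h : ℝ)) ^ x i / ((x i).factorial : ℝ)) := by
    intro i
    rw [← measureReal_def, poissonMeasure_real_singleton]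
    push_cast
    rw [Real.coe_toNNReal _ (hlam i), mul_div_assoc]
  simp_rw [this]
  rw [Finset.prod_mul_distrib, ← Real.exp_sum, Finset.sum_neg_distrib, ← Finset.sum_mul, neg_mul]

theorem totalJump_cast (x : Fin k → ℕ) :
    (totalJump x : ℝ) = ∑ i : Fin k, ((i : ℝ) + 1) * (x i : ℝ) := by
  simp [totalJump]

theorem memLp_eval_jumpCountLaw (lam : Fin k → ℝ) (h : ℝ≥0) (i : Fin k) :
    MemLp (fun x : Fin k → ℕ => (x i : ℝ)) 2 (jumpCountLaw lam h) :=
  (memLp_natCast_poissonMeasure _).comp_measurePreserving (measurePreserving_eval _ i)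

theorem memLp_totalJump (lam : Fin k → ℝ) (h : ℝ≥0) :
    MemLp (fun x : Fin k → ℕ => (totalJump x : ℝ)) 2 (jumpCountLaw lam h) := by
  simp_rw [totalJump_cast]
  exact memLp_finsetSum _ fun i _ => (memLp_eval_jumpCountLaw lam h i).const_mul _

theorem integral_totalJump (lam : Fin k → ℝ) (hlam : ∀ i, 0 ≤ lam i) (h : ℝ≥0) :
    ∫ x, (totalJump x : ℝ) ∂jumpCountLaw lam h = rateSum lam * h := by
  simp_rw [totalJump_cast]
  rw [integral_finsetSum _ fun i _ =>
    ((memLp_eval_jumpCountLaw lam h i).integrable one_le_two).const_mul _, rateSum, Finset.sum_mul]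
  refine Finset.sum_congr rfl fun i _ => ?_
  have h1 : ∫ x, ((x i : ℕ) : ℝ) ∂jumpCountLaw lam h = lam i * h := by
    have := integral_natCast_poissonMeasure ((lam i).toNNReal * h)
    have hp := measurePreserving_eval (fun i => poissonMeasure ((lam i).toNNReal * h)) i
    rw [← hp.map_eq,
      integral_map hp.measurable.aemeasurable (by fun_prop)] at this
    simpa [jumpCountLaw, hlam i] using this
  rw [integral_const_mul, h1, mul_assoc]

theorem variance_totalJump (lam : Fin k → ℝ) (hlam : ∀ i, 0 ≤ lam i) (h : ℝ≥0) :
    variance (fun x : Fin k → ℕ => (totalJump x : ℝ)) (jumpCountLaw lam h)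
      = rateSqSum lam * h := by
  have hfun : (fun x : Fin k → ℕ => (totalJump x : ℝ))
      = ∑ i : Fin k, fun x : Fin k → ℕ => ((i : ℝ) + 1) * (x i : ℝ) := by
    ext x; simp [totalJump_cast]
  have hind : iIndepFun (fun (i : Fin k) (x : Fin k → ℕ) => ((i : ℝ) + 1) * (x i : ℝ))
      (jumpCountLaw lam h) :=
    iIndepFun_pi (X := fun (i : Fin k) (n : ℕ) => ((i : ℝ) + 1) * (n : ℝ)) fun i => by fun_prop
  rw [hfun, IndepFun.variance_sum (fun i _ => (memLp_eval_jumpCountLaw lam h i).const_mul _)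
    fun i _ j _ hij => hind.indepFun hij, rateSqSum, Finset.sum_mul]
  refine Finset.sum_congr rfl fun i _ => ?_
  have h1 : variance (fun x : Fin k → ℕ => (x i : ℝ)) (jumpCountLaw lam h) = lam i * h := by
    have := variance_natCast_poissonMeasure ((lam i).toNNReal * h)
    have hp := measurePreserving_eval (fun i => poissonMeasure ((lam i).toNNReal * h)) i
    rw [← hp.map_eq,
      variance_map .of_discrete hp.measurable.aemeasurable] at this
    simpa [jumpCountLaw, hlam i, Function.comp_def] using this
  rw [variance_const_mul, h1, mul_assoc]

end jumpLaw

/-! ### Moments of the generalized counting process. -/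

namespace IsGeneralizedCountingProcess

variable {Ω : Type*} [MeasurableSpace Ω] {μ : Measure Ω} [IsProbabilityMeasure μ] {k : ℕ}
  {lam : Fin k → ℝ} {N : ℝ≥0 → Ω → ℕ}

theorem identDistrib_increment (hN : IsGeneralizedCountingProcess lam N μ)
    (hlam : ∀ i, 0 ≤ lam i) (s h : ℝ≥0) :
    IdentDistrib (fun ω => (N (s + h) ω : ℝ) - N s ω) (fun x => (totalJump x : ℝ))
      μ (jumpCountLaw lam h) := by
  have hmeas : Measurable fun ω => N (s + h) ω - N s ω :=
    (hN.measurable _).sub (hN.measurable _)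
  -- The subtraction here is truncated in `ℕ`; monotone paths make it the true increment almost
  -- surely.
  have key : IdentDistrib (fun ω => N (s + h) ω - N s ω) (fun x : Fin k → ℕ => totalJump x)
      μ (jumpCountLaw lam h) := by
    refine ⟨hmeas.aemeasurable, .of_discrete, ?_⟩
    refine Measure.ext_of_singleton fun n => ?_
    rw [Measure.map_apply hmeas (measurableSet_singleton n),
      Measure.map_apply .of_discrete (measurableSet_singleton n)]
    have h1 : μ ((fun ω => N (s + h) ω - N s ω) ⁻¹' {n}) = μ {ω | N (s + h) ω = N s ω + n} := by
      refine measure_congr ?_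
      filter_upwards [hN.monotone_paths] with ω hm
      have : N s ω ≤ N (s + h) ω := hm le_self_add
      refine propext ?_
      change N (s + h) ω - N s ω = n ↔ N (s + h) ω = N s ω + n
      omega
    rw [h1]
    have h2 := hN.increment_law s h n
    rw [← jumpCountLaw_totalJump lam hlam, measureReal_def, measureReal_def] at h2
    exact (ENNReal.toReal_eq_toReal_iff' (measure_ne_top _ _) (measure_ne_top _ _)).1 h2
  refine IdentDistrib.trans ?_ (key.comp (u := fun n : ℕ => (n : ℝ)) (by fun_prop))
  refine IdentDistrib.of_ae_eq
    ((measurable_from_top.comp (hN.measurable _)).sub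
      (measurable_from_top.comp (hN.measurable _))).aemeasurable ?_
  filter_upwards [hN.monotone_paths] with ω hm
  exact (Nat.cast_sub (hm le_self_add)).symm

theorem identDistrib (hN : IsGeneralizedCountingProcess lam N μ) (hlam : ∀ i, 0 ≤ lam i)
    (h : ℝ≥0) :
    IdentDistrib (fun ω => (N h ω : ℝ)) (fun x => (totalJump x : ℝ)) μ (jumpCountLaw lam h) := by
  refine IdentDistrib.trans ?_ (hN.identDistrib_increment hlam 0 h)
  refine IdentDistrib.of_ae_eq (measurable_from_top.comp (hN.measurable _)).aemeasurable ?_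
  filter_upwards [hN.start_zero] with ω h0
  simp [h0]

theorem memLp (hN : IsGeneralizedCountingProcess lam N μ) (hlam : ∀ i, 0 ≤ lam i) (h : ℝ≥0) :
    MemLp (fun ω => (N h ω : ℝ)) 2 μ :=
  (hN.identDistrib hlam h).symm.memLp_snd (memLp_totalJump lam h)

theorem integral_eq (hN : IsGeneralizedCountingProcess lam N μ) (hlam : ∀ i, 0 ≤ lam i)
    (h : ℝ≥0) : ∫ ω, (N h ω : ℝ) ∂μ = rateSum lam * h := by
  rw [(hN.identDistrib hlam h).integral_eq, integral_totalJump lam hlam]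

/-- Split `N(b) = N(a) + (N(b) - N(a))`, where the increment is independent of `N(a)`. -/
theorem integral_mul (hN : IsGeneralizedCountingProcess lam N μ) (hlam : ∀ i, 0 ≤ lam i)
    {a b : ℝ≥0} (hab : a ≤ b) :
    ∫ ω, (N a ω : ℝ) * N b ω ∂μ = rateSqSum lam * a + rateSum lam ^ 2 * a * b := by
  have hsq : ∫ ω, (N a ω : ℝ) ^ 2 ∂μ = rateSqSum lam * a + (rateSum lam * a) ^ 2 := by
    have h1 := variance_eq_sub (hN.memLp hlam a)
    rw [(hN.identDistrib hlam a).variance_eq, variance_totalJump lam hlam,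
      hN.integral_eq hlam] at h1
    simp only [Pi.pow_apply] at h1
    linarith
  have hind := hN.indep_increments.indepFun_eval_sub (zero_le (a := a)) hab
    (by filter_upwards [hN.start_zero] with ω h0; simp [h0])
  have hinc : ∫ ω, ((N b ω : ℝ) - N a ω) ∂μ = rateSum lam * b - rateSum lam * a := by
    rw [integral_sub ((hN.memLp hlam b).integrable one_le_two)
      ((hN.memLp hlam a).integrable one_le_two), hN.integral_eq hlam, hN.integral_eq hlam]
  have hprod : ∫ ω, (N a ω : ℝ) * ((N b ω : ℝ) - N a ω) ∂μ
      = rateSum lam * a * (rateSum lam * b - rateSum lam * a) := by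
    rw [← hinc, ← hN.integral_eq hlam]
    exact hind.integral_fun_mul_eq_mul_integral (hN.memLp hlam a).aestronglyMeasurable
      ((hN.memLp hlam b).sub (hN.memLp hlam a)).aestronglyMeasurable
  have hint1 : Integrable (fun ω => (N a ω : ℝ) ^ 2) μ := (hN.memLp hlam a).integrable_sq
  have hint2 : Integrable (fun ω => (N a ω : ℝ) * ((N b ω : ℝ) - N a ω)) μ :=
    (hN.memLp hlam a).integrable_mul ((hN.memLp hlam b).sub (hN.memLp hlam a))
  calc ∫ ω, (N a ω : ℝ) * N b ω ∂μ
      = ∫ ω, ((N a ω : ℝ) ^ 2 + (N a ω : ℝ) * ((N b ω : ℝ) - N a ω)) ∂μ := by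
        congr 1; ext ω; ring
    _ = _ := by
        rw [integral_add hint1 hint2, hsq, hprod]; ring

end IsGeneralizedCountingProcess

/-! ### Integration conditionally on an independent variable. -/

section fubini

variable {Ω E F G : Type*} [MeasurableSpace Ω] [MeasurableSpace E] [MeasurableSpace F]
  [MeasurableSpace G] {μ : Measure Ω} [IsProbabilityMeasure μ]

/-- The joint law is a triple product, so it may be regrouped. This isolates `D` from the pair
(claims, counting process). -/
theorem indepFun_prodMk_left_of_indepFun_prodMk_right {X : Ω → E} {Y : Ω → F} {Z : Ω → G}
    (hX : Measurable X) (hY : Measurable Y) (hZ : Measurable Z)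
    (hXYZ : IndepFun X (fun ω => (Y ω, Z ω)) μ) (hYZ : IndepFun Y Z μ) :
    IndepFun (fun ω => (X ω, Y ω)) Z μ := by
  have hXY : IndepFun X Y μ := hXYZ.comp measurable_id measurable_fst
  rw [indepFun_iff_map_prod_eq_prod_map_map (by fun_prop) (by fun_prop)] at hXYZ hYZ hXY ⊢
  have := Measure.isProbabilityMeasure_map (μ := μ) hX.aemeasurable
  have := Measure.isProbabilityMeasure_map (μ := μ) hY.aemeasurable
  have := Measure.isProbabilityMeasure_map (μ := μ) hZ.aemeasurable
  refine (MeasurableEquiv.prodAssoc (α := E) (β := F) (γ := G)).map_measurableEquiv_injective ?_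
  rw [hXY, Measure.prodAssoc_prod, ← hYZ, ← hXYZ, Measure.map_map (by fun_prop) (by fun_prop)]
  rfl

theorem ProbabilityTheory.IndepFun.integral_comp_eq_integral_integral {V : Ω → E} {W : Ω → F} {f : E × F → ℝ}
    (hV : AEMeasurable V μ) (hW : AEMeasurable W μ) (hVW : IndepFun V W μ) (hf : Measurable f)
    (hint : Integrable (fun ω => f (V ω, W ω)) μ) :
    ∫ ω, f (V ω, W ω) ∂μ = ∫ ω, ∫ ω', f (V ω', W ω) ∂μ ∂μ := by
  have hmap := (indepFun_iff_map_prod_eq_prod_map_map hV hW).1 hVW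
  have := Measure.isProbabilityMeasure_map (μ := μ) hV
  have := Measure.isProbabilityMeasure_map (μ := μ) hW
  have hint' : Integrable f ((μ.map V).prod (μ.map W)) := by
    rw [← hmap, integrable_map_measure hf.aestronglyMeasurable (hV.prodMk hW)]
    exact hint
  calc ∫ ω, f (V ω, W ω) ∂μ = ∫ p, f p ∂((μ.map V).prod (μ.map W)) := by
        rw [← hmap, integral_map (hV.prodMk hW) hf.aestronglyMeasurable]
    _ = ∫ w, ∫ v, f (v, w) ∂μ.map V ∂μ.map W := integral_prod_symm _ hint'
    _ = ∫ ω, ∫ v, f (v, W ω) ∂μ.map V ∂μ := by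
        rw [integral_map hW]
        exact (StronglyMeasurable.integral_prod_right (f := fun w v => f (v, w))
          (hf.comp measurable_swap).stronglyMeasurable).aestronglyMeasurable
    _ = _ := by
        congr 1; ext ω
        exact integral_map hV (hf.comp measurable_prodMk_right).aestronglyMeasurable

theorem ProbabilityTheory.IndepFun.memLp_two_comp {V : Ω → E} {W : Ω → F} {f : E × F → ℝ}
    (hV : AEMeasurable V μ) (hW : AEMeasurable W μ) (hVW : IndepFun V W μ) (hf : Measurable f)
    (h1 : ∀ w, MemLp (fun ω => f (V ω, w)) 2 μ)
    (h2 : Integrable (fun ω => ∫ ω', f (V ω', W ω) ^ 2 ∂μ) μ) :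
    MemLp (fun ω => f (V ω, W ω)) 2 μ := by
  have hmap := (indepFun_iff_map_prod_eq_prod_map_map hV hW).1 hVW
  have := Measure.isProbabilityMeasure_map (μ := μ) hV
  have := Measure.isProbabilityMeasure_map (μ := μ) hW
  have hf2 : Measurable fun p => f p ^ 2 := hf.pow_const 2
  suffices h : Integrable (fun p => f p ^ 2) (μ.map fun ω => (V ω, W ω)) by
    have hm : AEMeasurable (fun ω => f (V ω, W ω)) μ := hf.comp_aemeasurable (hV.prodMk hW)
    rw [memLp_two_iff_integrable_sq hm.aestronglyMeasurable]
    exact (integrable_map_measure hf2.aestronglyMeasurable (hV.prodMk hW)).1 h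
  rw [hmap, integrable_prod_iff' hf2.aestronglyMeasurable]
  refine ⟨.of_forall fun w => ?_, ?_⟩
  · exact (integrable_map_measure (hf2.comp measurable_prodMk_right).aestronglyMeasurable hV).2
      (h1 w).integrable_sq
  · rw [integrable_map_measure _ hW]
    · refine h2.congr (.of_forall fun ω => ?_)
      simp only [Function.comp_apply]
      rw [integral_map (f := fun v => ‖f (v, W ω) ^ 2‖) hV
        (hf2.norm.comp measurable_prodMk_right).aestronglyMeasurable]
      simp
    · exact (StronglyMeasurable.integral_prod_right (f := fun w v => ‖f (v, w) ^ 2‖)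
        (hf2.norm.comp measurable_swap).stronglyMeasurable).aestronglyMeasurable

end fubini

/-! ### Random sums of claims. -/

/-- The partial sums `∑_{j < n} x j` as a function of the sequence `x` and of `n`. -/
def partialSum (p : (ℕ → ℝ) × ℕ) : ℝ := ∑ j ∈ Finset.range p.2, p.1 j

theorem measurable_partialSum : Measurable partialSum :=
  measurable_from_prod_countable_left fun n => by
    simp only [partialSum]
    fun_prop

section claims

variable {Ω : Type*} [MeasurableSpace Ω] {μ : Measure Ω} {X : ℕ → Ω → ℝ}

theorem memLp_partialSum (hXident : ∀ j, IdentDistrib (X j) (X 0) μ μ) (hXL2 : MemLp (X 0) 2 μ)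
    (n : ℕ) : MemLp (fun ω => partialSum (fun j => X j ω, n)) 2 μ :=
  memLp_finsetSum (Finset.range n) fun j _ => (hXident j).symm.memLp_snd hXL2

variable [IsProbabilityMeasure μ]

theorem integral_partialSum (hXident : ∀ j, IdentDistrib (X j) (X 0) μ μ)
    (hXL2 : MemLp (X 0) 2 μ) (n : ℕ) :
    ∫ ω, partialSum (fun j => X j ω, n) ∂μ = n * ∫ ω, X 0 ω ∂μ := by
  simp only [partialSum]
  rw [integral_finsetSum _ fun j _ =>
    ((hXident j).symm.memLp_snd hXL2).integrable one_le_two]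
  simp_rw [fun j => (hXident j).integral_eq]
  simp

/-- Only the diagonal terms of the double sum of covariances survive, and there are `min n m` of
them. -/
theorem integral_partialSum_mul (hXindep : iIndepFun X μ)
    (hXident : ∀ j, IdentDistrib (X j) (X 0) μ μ)
    (hXL2 : MemLp (X 0) 2 μ) (n m : ℕ) :
    ∫ ω, partialSum (fun j => X j ω, n) * partialSum (fun j => X j ω, m) ∂μ
      = variance (X 0) μ * (min n m : ℕ) + (∫ ω, X 0 ω ∂μ) ^ 2 * ((n : ℝ) * m) := by
  have hX : ∀ j, MemLp (X j) 2 μ := fun j => (hXident j).symm.memLp_snd hXL2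
  have hcov : ∀ i j, covariance (X i) (X j) μ = if i = j then variance (X 0) μ else 0 := by
    intro i j
    split_ifs with hij
    · rw [hij, covariance_self (hX j).aemeasurable, (hXident j).variance_eq]
    · exact (hXindep.indepFun hij).covariance_eq_zero (hX i) (hX j)
  have h := covariance_eq_sub (memLp_partialSum hXident hXL2 n) (memLp_partialSum hXident hXL2 m)
  rw [integral_partialSum hXident hXL2, integral_partialSum hXident hXL2] at h
  have h' : covariance (fun ω => partialSum (fun j => X j ω, n))
      (fun ω => partialSum (fun j => X j ω, m)) μ = variance (X 0) μ * (min n m : ℕ) := by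
    simp only [partialSum]
    rw [covariance_fun_sum_fun_sum' (fun i _ => hX i) (fun i _ => hX i)]
    simp_rw [hcov]
    simp only [Finset.sum_ite_eq, Finset.mem_range]
    rw [← Finset.sum_filter, Finset.sum_const, nsmul_eq_mul, mul_comm]
    congr 3
    rw [← Finset.card_range (min n m)]
    congr 1
    ext; simp
  rw [h'] at h
  simp only [Pi.mul_apply] at h
  linear_combination -h

variable (hXmeas : ∀ j, Measurable (X j)) (hXindep : iIndepFun X μ)
    (hXident : ∀ j, IdentDistrib (X j) (X 0) μ μ) (hXL2 : MemLp (X 0) 2 μ)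

include hXmeas hXindep hXident hXL2

theorem memLp_partialSum_random {n : Ω → ℕ} (hn : Measurable n)
    (hnL2 : MemLp (fun ω => (n ω : ℝ)) 2 μ) (hXn : IndepFun (fun ω j => X j ω) n μ) :
    MemLp (fun ω => partialSum (fun j => X j ω, n ω)) 2 μ := by
  refine IndepFun.memLp_two_comp (V := fun ω j => X j ω) (by fun_prop) hn.aemeasurable hXn
    measurable_partialSum (memLp_partialSum hXident hXL2) ?_
  simp_rw [pow_two, integral_partialSum_mul hXindep hXident hXL2, min_self]
  refine Integrable.add ((hnL2.integrable one_le_two).const_mul _) (Integrable.const_mul ?_ _)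
  exact hnL2.integrable_mul hnL2

theorem integral_partialSum_random {n : Ω → ℕ} (hn : Measurable n)
    (hnL2 : MemLp (fun ω => (n ω : ℝ)) 2 μ) (hXn : IndepFun (fun ω j => X j ω) n μ) :
    ∫ ω, partialSum (fun j => X j ω, n ω) ∂μ = (∫ ω, (n ω : ℝ) ∂μ) * ∫ ω, X 0 ω ∂μ := by
  rw [IndepFun.integral_comp_eq_integral_integral (V := fun ω j => X j ω) (by fun_prop)
    hn.aemeasurable hXn measurable_partialSum
    ((memLp_partialSum_random hXmeas hXindep hXident hXL2 hn hnL2 hXn).integrable one_le_two)]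
  simp_rw [integral_partialSum hXident hXL2]
  rw [integral_mul_const]

theorem integral_partialSum_mul_random {n m : Ω → ℕ} (hn : Measurable n) (hm : Measurable m)
    (hnm : ∀ᵐ ω ∂μ, n ω ≤ m ω)
    (hnL2 : MemLp (fun ω => (n ω : ℝ)) 2 μ) (hmL2 : MemLp (fun ω => (m ω : ℝ)) 2 μ)
    (hXnm : IndepFun (fun ω j => X j ω) (fun ω => (n ω, m ω)) μ) :
    ∫ ω, partialSum (fun j => X j ω, n ω) * partialSum (fun j => X j ω, m ω) ∂μ
      = variance (X 0) μ * (∫ ω, (n ω : ℝ) ∂μ)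
        + (∫ ω, X 0 ω ∂μ) ^ 2 * ∫ ω, (n ω : ℝ) * m ω ∂μ := by
  have hn' := memLp_partialSum_random hXmeas hXindep hXident hXL2 hn hnL2
    (hXnm.comp measurable_id measurable_fst)
  have hm' := memLp_partialSum_random hXmeas hXindep hXident hXL2 hm hmL2
    (hXnm.comp measurable_id measurable_snd)
  have hf : Measurable fun p : (ℕ → ℝ) × (ℕ × ℕ) =>
      partialSum (p.1, p.2.1) * partialSum (p.1, p.2.2) :=
    (measurable_partialSum.comp (by fun_prop)).mul (measurable_partialSum.comp (by fun_prop))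
  have := IndepFun.integral_comp_eq_integral_integral (V := fun ω j => X j ω)
    (W := fun ω => (n ω, m ω)) (by fun_prop) (by fun_prop) hXnm hf (hn'.integrable_mul hm')
  have hnm2 : Integrable (fun ω => (n ω : ℝ) * m ω) μ := hnL2.integrable_mul hmL2
  simp only at this
  rw [this]
  simp_rw [integral_partialSum_mul hXindep hXident hXL2]
  rw [← integral_const_mul, ← integral_const_mul,
    ← integral_add ((hnL2.integrable one_le_two).const_mul _) (hnm2.const_mul _)]
  refine integral_congr_ae ?_
  filter_upwards [hnm] with ω h
  simp [min_eq_left h]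

end claims

/-! ### Joint measurability of path evaluation. -/

/-- A point to the right of `r`, at distance at most `1 / (m + 1)`. -/
noncomputable def rightApprox (m : ℕ) (r : ℝ≥0) : ℝ≥0 :=
  ((⌊r * (m + 1)⌋₊ : ℝ≥0) + 1) / (m + 1)

theorem lt_rightApprox (m : ℕ) (r : ℝ≥0) : r < rightApprox m r := by
  rw [rightApprox, lt_div_iff₀ (by positivity)]
  exact Nat.lt_floor_add_one _

theorem rightApprox_le (m : ℕ) (r : ℝ≥0) : rightApprox m r ≤ r + 1 / (m + 1) := by
  rw [rightApprox, add_div]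
  gcongr
  rw [div_le_iff₀ (by positivity)]
  exact Nat.floor_le zero_le

theorem tendsto_rightApprox (r : ℝ≥0) :
    Filter.Tendsto (fun m => rightApprox m r) Filter.atTop (nhdsWithin r (Set.Ici r)) := by
  refine tendsto_nhdsWithin_iff.2 ⟨?_, .of_forall fun m => (lt_rightApprox m r).le⟩
  refine tendsto_of_tendsto_of_tendsto_of_le_of_le tendsto_const_nhds ?_
    (fun m => (lt_rightApprox m r).le) (fun m => rightApprox_le m r)
  have : Filter.Tendsto (fun m : ℕ => r + 1 / ((m : ℝ≥0) + 1)) Filter.atTop (nhds (r + 0)) :=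
    tendsto_const_nhds.add tendsto_one_div_add_atTop_nhds_zero_nat
  simpa using this

/-- Jointly measurable evaluation of nondecreasing right-continuous paths. -/
noncomputable def pathEval (p : (ℝ≥0 → ℕ) × ℝ≥0) : ℕ := ⨅ m : ℕ, p.1 (rightApprox m p.2)

/-- `rightApprox m` depends on the time only through a natural number, so each term factors through
a product with a countable space. -/
theorem measurable_pathEval : Measurable pathEval := by
  refine Measurable.iInf fun m => ?_
  have h1 : Measurable fun q : (ℝ≥0 → ℕ) × ℕ => q.1 (((q.2 : ℝ≥0) + 1) / (m + 1)) :=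
    measurable_from_prod_countable_left fun n => by
      simp only
      fun_prop
  have h2 : Measurable fun p : (ℝ≥0 → ℕ) × ℝ≥0 => (p.1, ⌊p.2 * (m + 1)⌋₊) := by
    fun_prop
  exact h1.comp h2

theorem pathEval_eq {n : ℝ≥0 → ℕ} (hmono : Monotone n)
    (hcont : ∀ t, ContinuousWithinAt n (Set.Ici t) t) (r : ℝ≥0) : pathEval (n, r) = n r := by
  refine le_antisymm ?_ (le_ciInf fun m => hmono (lt_rightApprox m r).le)
  have h : Filter.Tendsto (fun m => n (rightApprox m r)) Filter.atTop (nhds (n r)) :=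
    Filter.Tendsto.comp (hcont r) (tendsto_rightApprox r)
  -- In the discrete space `ℕ` convergence is eventual equality, so the infimum is attained.
  rw [nhds_discrete, Filter.tendsto_pure] at h
  obtain ⟨m, hm⟩ := h.exists
  exact (ciInf_le (OrderBot.bddBelow _) m).trans_eq hm

/-! ### Compensated claims at deterministic times. -/

/-- The compensated aggregate claim process `∑_{j < N(r)} X_j - c r`. -/
noncomputable def compensatedClaims {Ω : Type*} (N : ℝ≥0 → Ω → ℕ) (X : ℕ → Ω → ℝ) (c : ℝ)
    (r : ℝ≥0) (ω : Ω) : ℝ := partialSum (fun j => X j ω, N r ω) - c * r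

/-- The compensated aggregate claims as a jointly measurable function of the claims, the path of
the counting process and the time. -/
noncomputable def compensatedClaimsMap (c : ℝ) (p : ((ℕ → ℝ) × (ℝ≥0 → ℕ)) × ℝ≥0) : ℝ :=
  partialSum (p.1.1, pathEval (p.1.2, p.2)) - c * p.2

theorem measurable_compensatedClaimsMap (c : ℝ) : Measurable (compensatedClaimsMap c) := by
  have h1 : Measurable fun p : ((ℕ → ℝ) × (ℝ≥0 → ℕ)) × ℝ≥0 => pathEval (p.1.2, p.2) :=
    measurable_pathEval.comp (by fun_prop)
  have h2 : Measurable fun p : ((ℕ → ℝ) × (ℝ≥0 → ℕ)) × ℝ≥0 =>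
      partialSum (p.1.1, pathEval (p.1.2, p.2)) :=
    measurable_partialSum.comp ((measurable_fst.comp measurable_fst).prodMk h1)
  exact h2.sub (by fun_prop)

section

variable {Ω : Type*} [MeasurableSpace Ω] {μ : Measure Ω} {k : ℕ}
  {lam : Fin k → ℝ} {N : ℝ≥0 → Ω → ℕ} {X : ℕ → Ω → ℝ}

/-- The exceptional null set does not depend on `r`, which permits substituting a random time. -/
theorem ae_compensatedClaimsMap_eq (hN : IsGeneralizedCountingProcess lam N μ) (c : ℝ) :
    ∀ᵐ ω ∂μ, ∀ r, compensatedClaimsMap c ((fun j => X j ω, fun t => N t ω), r)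
      = compensatedClaims N X c r ω := by
  filter_upwards [hN.monotone_paths, hN.rightCts_paths] with ω hm hc r
  simp only [compensatedClaimsMap, compensatedClaims]
  rw [pathEval_eq hm hc]

variable [IsProbabilityMeasure μ] (hN : IsGeneralizedCountingProcess lam N μ) (hlam : ∀ i, 0 ≤ lam i)
  (hXmeas : ∀ j, Measurable (X j)) (hXindep : iIndepFun X μ)
  (hXident : ∀ j, IdentDistrib (X j) (X 0) μ μ) (hXL2 : MemLp (X 0) 2 μ)
  (hXN : IndepFun (fun ω j => X j ω) (fun ω t => N t ω) μ)

include hN hlam hXmeas hXindep hXident hXL2 hXN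

theorem memLp_compensatedClaims (c : ℝ) (r : ℝ≥0) : MemLp (compensatedClaims N X c r) 2 μ :=
  (memLp_partialSum_random hXmeas hXindep hXident hXL2 (hN.measurable r) (hN.memLp hlam r)
    (hXN.comp measurable_id (measurable_pi_apply r))).sub (memLp_const _)

theorem integral_compensatedClaims (r : ℝ≥0) :
    ∫ ω, compensatedClaims N X ((∫ ω, X 0 ω ∂μ) * rateSum lam) r ω ∂μ = 0 := by
  have hind := hXN.comp measurable_id (measurable_pi_apply r)
  unfold compensatedClaims
  rw [integral_sub ((memLp_partialSum_random hXmeas hXindep hXident hXL2 (hN.measurable r)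
    (hN.memLp hlam r) hind).integrable one_le_two) (integrable_const _),
    integral_partialSum_random hXmeas hXindep hXident hXL2 (hN.measurable r) (hN.memLp hlam r) hind,
    hN.integral_eq hlam]
  simp; ring

/-- By centring this is a covariance, unchanged when the deterministic drifts are dropped; the `a *
b` terms of the random sums then cancel. -/
theorem integral_compensatedClaims_mul {a b : ℝ≥0} (hab : a ≤ b) :
    ∫ ω, compensatedClaims N X ((∫ ω, X 0 ω ∂μ) * rateSum lam) a ω
        * compensatedClaims N X ((∫ ω, X 0 ω ∂μ) * rateSum lam) b ω ∂μ
      = (variance (X 0) μ * rateSum lam + (∫ ω, X 0 ω ∂μ) ^ 2 * rateSqSum lam) * a := by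
  set c := (∫ ω, X 0 ω ∂μ) * rateSum lam with hc
  have hZ := fun r => memLp_compensatedClaims hN hlam hXmeas hXindep hXident hXL2 hXN c r
  have hS := fun r => memLp_partialSum_random hXmeas hXindep hXident hXL2 (hN.measurable r)
    (hN.memLp hlam r) (hXN.comp measurable_id (measurable_pi_apply r))
  have hES := fun r => integral_partialSum_random hXmeas hXindep hXident hXL2 (hN.measurable r)
    (hN.memLp hlam r) (hXN.comp measurable_id (measurable_pi_apply r))
  have hSS := integral_partialSum_mul_random hXmeas hXindep hXident hXL2 (hN.measurable a)
    (hN.measurable b) (by filter_upwards [hN.monotone_paths] with ω hm using hm hab)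
    (hN.memLp hlam a) (hN.memLp hlam b)
    (hXN.comp measurable_id ((measurable_pi_apply a).prodMk (measurable_pi_apply b)))
  simp_rw [hN.integral_eq hlam] at hES
  rw [hN.integral_eq hlam, hN.integral_mul hlam hab] at hSS
  have hcov := covariance_eq_sub (hS a) (hS b)
  simp only [Pi.mul_apply] at hcov
  have hcov' := covariance_eq_sub (hZ a) (hZ b)
  have h0 := integral_compensatedClaims hN hlam hXmeas hXindep hXident hXL2 hXN
  simp only [Pi.mul_apply] at hcov'
  rw [← hc] at h0
  rw [h0 a, zero_mul, sub_zero] at hcov'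
  rw [← hcov']
  change covariance (fun ω => partialSum (fun j => X j ω, N a ω) - c * a)
    (fun ω => partialSum (fun j => X j ω, N b ω) - c * b) μ = _
  rw [covariance_sub_const_left ((hS a).integrable one_le_two),
    covariance_sub_const_right ((hS b).integrable one_le_two), hcov, hSS, hES, hES]
  ring

end

/-! ### Compensated claims at independent random times. -/

section timeChange

variable {Ω : Type*} [MeasurableSpace Ω] {μ : Measure Ω} [IsProbabilityMeasure μ] {k : ℕ}
  {lam : Fin k → ℝ} {N : ℝ≥0 → Ω → ℕ} {X : ℕ → Ω → ℝ} {U W : Ω → ℝ≥0}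

variable (hN : IsGeneralizedCountingProcess lam N μ) (hlam : ∀ i, 0 ≤ lam i)
  (hXmeas : ∀ j, Measurable (X j)) (hXindep : iIndepFun X μ)
  (hXident : ∀ j, IdentDistrib (X j) (X 0) μ μ) (hXL2 : MemLp (X 0) 2 μ)
  (hXN : IndepFun (fun ω j => X j ω) (fun ω t => N t ω) μ)
  (hU : AEMeasurable U μ) (hW : AEMeasurable W μ)
  (hUL2 : MemLp (fun ω => (U ω : ℝ)) 2 μ) (hWL2 : MemLp (fun ω => (W ω : ℝ)) 2 μ)

include hN hlam hXmeas hXindep hXident hXL2 hXN hW hWL2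

theorem memLp_compensatedClaims_random
    (hind : IndepFun (fun ω => ((fun j => X j ω), (fun t => N t ω))) W μ) :
    MemLp (fun ω => compensatedClaims N X ((∫ ω, X 0 ω ∂μ) * rateSum lam) (W ω) ω) 2 μ := by
  set c := (∫ ω, X 0 ω ∂μ) * rateSum lam with hc
  have hae := ae_compensatedClaimsMap_eq (X := X) hN c
  have hV : Measurable fun ω => ((fun j => X j ω), (fun t => N t ω)) :=
    (measurable_pi_lambda _ hXmeas).prodMk (measurable_pi_lambda _ hN.measurable)
  refine MemLp.ae_eq (f := fun ω => compensatedClaimsMap c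
    ((fun j => X j ω, fun t => N t ω), W ω)) ?_ ?_
  · filter_upwards [hae] with ω h using h _
  refine IndepFun.memLp_two_comp hV.aemeasurable hW hind (measurable_compensatedClaimsMap c)
    (fun w => ?_) ?_
  · refine (memLp_compensatedClaims hN hlam hXmeas hXindep hXident hXL2 hXN c w).ae_eq ?_
    filter_upwards [hae] with ω h using (h _).symm
  -- Given `W = w`, the second moment is a constant times `w`, so integrability of `W` suffices.
  · refine ((hWL2.integrable one_le_two).const_mul
      (variance (X 0) μ * rateSum lam + (∫ ω, X 0 ω ∂μ) ^ 2 * rateSqSum lam)).congr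
      (.of_forall fun ω => ?_)
    simp only
    rw [← integral_compensatedClaims_mul hN hlam hXmeas hXindep hXident hXL2 hXN le_rfl]
    refine integral_congr_ae ?_
    filter_upwards [hae] with ω' h
    rw [h, pow_two]

theorem integral_compensatedClaims_random
    (hind : IndepFun (fun ω => ((fun j => X j ω), (fun t => N t ω))) W μ) :
    ∫ ω, compensatedClaims N X ((∫ ω, X 0 ω ∂μ) * rateSum lam) (W ω) ω ∂μ = 0 := by
  have hL2 := memLp_compensatedClaims_random hN hlam hXmeas hXindep hXident hXL2 hXN hW hWL2 hind
  set c := (∫ ω, X 0 ω ∂μ) * rateSum lam with hc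
  have hae := ae_compensatedClaimsMap_eq (X := X) hN c
  have hV : Measurable fun ω => ((fun j => X j ω), (fun t => N t ω)) :=
    (measurable_pi_lambda _ hXmeas).prodMk (measurable_pi_lambda _ hN.measurable)
  have hcongr : (fun ω => compensatedClaims N X c (W ω) ω) =ᵐ[μ]
      fun ω => compensatedClaimsMap c ((fun j => X j ω, fun t => N t ω), W ω) := by
    filter_upwards [hae] with ω h using (h _).symm
  rw [integral_congr_ae hcongr, IndepFun.integral_comp_eq_integral_integral hV.aemeasurable hW hind
    (measurable_compensatedClaimsMap c) ((hL2.integrable one_le_two).congr hcongr)]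
  refine integral_eq_zero_of_ae (.of_forall fun ω => ?_)
  simp only [Pi.zero_apply]
  rw [← integral_compensatedClaims hN hlam hXmeas hXindep hXident hXL2 hXN (W ω)]
  refine integral_congr_ae ?_
  filter_upwards [hae] with ω' h using h _

include hU hUL2

/-- Given `(U, W)`, the factor `U` is a constant and the compensated claims have mean zero. -/
theorem integral_mul_compensatedClaims_random
    (hind : IndepFun (fun ω => ((fun j => X j ω), (fun t => N t ω))) (fun ω => (U ω, W ω)) μ) :
    ∫ ω, (U ω : ℝ) * compensatedClaims N X ((∫ ω, X 0 ω ∂μ) * rateSum lam) (W ω) ω ∂μ = 0 := by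
  have hL2 := memLp_compensatedClaims_random hN hlam hXmeas hXindep hXident hXL2 hXN hW hWL2
    (hind.comp measurable_id measurable_snd)
  set c := (∫ ω, X 0 ω ∂μ) * rateSum lam with hc
  have hae := ae_compensatedClaimsMap_eq (X := X) hN c
  have hV : Measurable fun ω => ((fun j => X j ω), (fun t => N t ω)) :=
    (measurable_pi_lambda _ hXmeas).prodMk (measurable_pi_lambda _ hN.measurable)
  have hf : Measurable fun p : ((ℕ → ℝ) × (ℝ≥0 → ℕ)) × (ℝ≥0 × ℝ≥0) =>
      (p.2.1 : ℝ) * compensatedClaimsMap c (p.1, p.2.2) :=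
    Measurable.mul (by fun_prop) ((measurable_compensatedClaimsMap c).comp (by fun_prop))
  have hcongr : (fun ω => (U ω : ℝ) * compensatedClaims N X c (W ω) ω) =ᵐ[μ]
      fun ω => (U ω : ℝ) * compensatedClaimsMap c ((fun j => X j ω, fun t => N t ω), W ω) := by
    filter_upwards [hae] with ω h
    rw [h]
  have hfub := IndepFun.integral_comp_eq_integral_integral hV.aemeasurable (hU.prodMk hW) hind hf
    (Integrable.congr (hUL2.integrable_mul hL2) hcongr)
  simp only at hfub
  rw [integral_congr_ae hcongr, hfub]
  refine integral_eq_zero_of_ae (.of_forall fun ω => ?_)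
  simp only [Pi.zero_apply]
  rw [integral_const_mul, mul_eq_zero]
  right
  rw [← integral_compensatedClaims hN hlam hXmeas hXindep hXident hXL2 hXN (W ω)]
  refine integral_congr_ae ?_
  filter_upwards [hae] with ω' h using h _

theorem integral_compensatedClaims_mul_random (hUW : ∀ᵐ ω ∂μ, U ω ≤ W ω)
    (hind : IndepFun (fun ω => ((fun j => X j ω), (fun t => N t ω))) (fun ω => (U ω, W ω)) μ) :
    ∫ ω, compensatedClaims N X ((∫ ω, X 0 ω ∂μ) * rateSum lam) (U ω) ω
        * compensatedClaims N X ((∫ ω, X 0 ω ∂μ) * rateSum lam) (W ω) ω ∂μ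
      = (variance (X 0) μ * rateSum lam + (∫ ω, X 0 ω ∂μ) ^ 2 * rateSqSum lam)
        * ∫ ω, (U ω : ℝ) ∂μ := by
  have hL2 := memLp_compensatedClaims_random hN hlam hXmeas hXindep hXident hXL2 hXN hW hWL2
    (hind.comp measurable_id measurable_snd)
  have hL2' := memLp_compensatedClaims_random hN hlam hXmeas hXindep hXident hXL2 hXN hU hUL2
    (hind.comp measurable_id measurable_fst)
  have hmul := @integral_compensatedClaims_mul _ _ _ _ _ _ _ _ hN hlam hXmeas hXindep hXident
    hXL2 hXN
  set c := (∫ ω, X 0 ω ∂μ) * rateSum lam with hc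
  have hae := ae_compensatedClaimsMap_eq (X := X) hN c
  have hV : Measurable fun ω => ((fun j => X j ω), (fun t => N t ω)) :=
    (measurable_pi_lambda _ hXmeas).prodMk (measurable_pi_lambda _ hN.measurable)
  have hf : Measurable fun p : ((ℕ → ℝ) × (ℝ≥0 → ℕ)) × (ℝ≥0 × ℝ≥0) =>
      compensatedClaimsMap c (p.1, p.2.1) * compensatedClaimsMap c (p.1, p.2.2) :=
    ((measurable_compensatedClaimsMap c).comp (by fun_prop)).mul
      ((measurable_compensatedClaimsMap c).comp (by fun_prop))
  have hcongr : (fun ω => compensatedClaims N X c (U ω) ω * compensatedClaims N X c (W ω) ω) =ᵐ[μ]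
      fun ω => compensatedClaimsMap c ((fun j => X j ω, fun t => N t ω), U ω)
        * compensatedClaimsMap c ((fun j => X j ω, fun t => N t ω), W ω) := by
    filter_upwards [hae] with ω h
    rw [h, h]
  have hfub := IndepFun.integral_comp_eq_integral_integral hV.aemeasurable (hU.prodMk hW) hind hf
    (Integrable.congr (hL2'.integrable_mul hL2) hcongr)
  simp only at hfub
  rw [integral_congr_ae hcongr, hfub, ← integral_const_mul]
  refine integral_congr_ae ?_
  filter_upwards [hUW] with ω hω
  rw [← hmul hω]
  refine integral_congr_ae ?_
  filter_upwards [hae] with ω' h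
  rw [h, h]

end timeChange

/-! ### Decomposition of the risk process and assembly. -/

theorem gfrp_eq {Ω : Type*} {k : ℕ} (lam : Fin k → ℝ) (ν η ρ : ℝ) (N : ℝ≥0 → Ω → ℕ)
    (D : ℝ≥0 → Ω → ℝ) (X : ℕ → Ω → ℝ) (t : ℝ≥0) :
    gfrp lam ν η ρ N D X t = fun ω => ν + (η * rateSum lam * ρ * (inverseSubordinator D t ω : ℝ)
      - compensatedClaims N X (η * rateSum lam) (inverseSubordinator D t ω) ω) := by
  ext ω
  simp only [gfrp, gfcp, compensatedClaims, partialSum]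
  ring

theorem mainTheorem2 {Ω : Type*} [MeasurableSpace Ω] (μ : Measure Ω) [IsProbabilityMeasure μ]
    (β : ℝ) (hβ0 : 0 < β) (hβ1 : β < 1)
    (k : ℕ) (hk : 1 ≤ k) (lam : Fin k → ℝ) (hlam : ∀ i, 0 < lam i)
    (ν η ρ : ℝ) (hν : 0 < ν) (hη : 0 < η)
    (N : ℝ≥0 → Ω → ℕ) (hN : IsGeneralizedCountingProcess lam N μ)
    (D : ℝ≥0 → Ω → ℝ) (hD : IsStableSubordinator β D μ)
    (X : ℕ → Ω → ℝ) (hXmeas : ∀ j, Measurable (X j))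
    (hXindep : iIndepFun X μ) (hXident : ∀ j, IdentDistrib (X j) (X 0) μ μ)
    (hXL2 : MemLp (X 0) 2 μ) (hXmean : ∫ ω, X 0 ω ∂μ = η)
    (hND : IndepFun (fun ω t => N t ω) (fun ω t => D t ω) μ)
    (hXND : IndepFun (fun ω j => X j ω)
      (fun ω => ((fun t => N t ω : ℝ≥0 → ℕ), (fun t => D t ω : ℝ≥0 → ℝ))) μ) :
    (∀ t : ℝ≥0, MemLp (fun ω => (inverseSubordinator D t ω : ℝ)) 2 μ ∧
      MemLp (gfrp lam ν η ρ N D X t) 2 μ) ∧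
    (∀ s t : ℝ≥0, 0 < s → s ≤ t →
      covariance (gfrp lam ν η ρ N D X t) (gfrp lam ν η ρ N D X s) μ =
        η ^ 2 * rateSum lam ^ 2 * ρ ^ 2 *
            covariance (fun ω => (inverseSubordinator D s ω : ℝ))
              (fun ω => (inverseSubordinator D t ω : ℝ)) μ
          + gfcpS β lam * (s : ℝ) ^ β * variance (X 0) μ
          + gfcpT β lam * (s : ℝ) ^ β * η ^ 2) ∧
    (∀ t : ℝ≥0, 0 < t →
      variance (gfrp lam ν η ρ N D X t) μ =
        η ^ 2 * rateSum lam ^ 2 * ρ ^ 2 *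
            variance (fun ω => (inverseSubordinator D t ω : ℝ)) μ
          + gfcpS β lam * (t : ℝ) ^ β * variance (X 0) μ
          + gfcpT β lam * (t : ℝ) ^ β * η ^ 2) := by

  have hlam' : ∀ i, 0 ≤ lam i := fun i => (hlam i).le
  have hNpath : Measurable fun ω t => N t ω := measurable_pi_lambda _ hN.measurable
  have hDpath : Measurable fun ω t => D t ω := measurable_pi_lambda _ hD.measurable
  have hXN : IndepFun (fun ω j => X j ω) (fun ω t => N t ω) μ :=
    hXND.comp measurable_id measurable_fst
  have hVD : IndepFun (fun ω => ((fun j => X j ω), (fun t => N t ω))) (fun ω t => D t ω) μ :=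
    indepFun_prodMk_left_of_indepFun_prodMk_right (measurable_pi_lambda _ hXmeas) hNpath hDpath
      hXND hND
  have hpair : ∀ s t, IndepFun (fun ω => ((fun j => X j ω), (fun t => N t ω)))
      (fun ω => (inverseSubordinator D s ω, inverseSubordinator D t ω)) μ := by
    intro s t
    -- `inverseSubordinator` agrees only almost surely with a measurable function of the path of
    -- `D`; independence passes through that modification.
    refine (hVD.comp measurable_id ((measurable_rationalPassageTime s).prodMk
      (measurable_rationalPassageTime t))).congr .rfl ?_
    filter_upwards [hD.monotone_paths] with ω hm
    simp [inverseSubordinator_eq_rationalPassageTime hm]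
  have hWm := fun t => hD.aemeasurable_inverseSubordinator t
  have hW := fun t => hD.memLp_inverseSubordinator t
  have hZ := fun t => memLp_compensatedClaims_random hN hlam' hXmeas hXindep hXident hXL2 hXN
    (hWm t) (hW t) ((hpair t t).comp measurable_id measurable_snd)
  have hZ0 := fun t => integral_compensatedClaims_random hN hlam' hXmeas hXindep hXident hXL2 hXN
    (hWm t) (hW t) ((hpair t t).comp measurable_id measurable_snd)
  have hWZ := fun s t => integral_mul_compensatedClaims_random hN hlam' hXmeas hXindep hXident hXL2
    hXN (hWm s) (hWm t) (hW s) (hW t) (hpair s t)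
  have hZZ := fun (s t : ℝ≥0) (hst : s ≤ t) =>
    integral_compensatedClaims_mul_random hN hlam' hXmeas hXindep hXident hXL2
    hXN (hWm s) (hWm t) (hW s) (hW t)
    (by filter_upwards [hD.ae_unbounded t] with ω hu using inverseSubordinator_mono hu hst)
    (hpair s t)
  simp_rw [hXmean] at hZ hZ0 hWZ hZZ
  have hcWZ : ∀ t, MemLp (fun ω => η * rateSum lam * ρ * (inverseSubordinator D t ω : ℝ)
      - compensatedClaims N X (η * rateSum lam) (inverseSubordinator D t ω) ω) 2 μ :=
    fun t => ((hW t).const_mul (η * rateSum lam * ρ)).sub (hZ t)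
  have hR : ∀ t, MemLp (gfrp lam ν η ρ N D X t) 2 μ := by
    intro t
    rw [gfrp_eq]
    exact (memLp_const ν).add (hcWZ t)
  have hcov : ∀ s t : ℝ≥0, s ≤ t →
      covariance (gfrp lam ν η ρ N D X t) (gfrp lam ν η ρ N D X s) μ =
        η ^ 2 * rateSum lam ^ 2 * ρ ^ 2 *
            covariance (fun ω => (inverseSubordinator D s ω : ℝ))
              (fun ω => (inverseSubordinator D t ω : ℝ)) μ
          + gfcpS β lam * (s : ℝ) ^ β * variance (X 0) μ
          + gfcpT β lam * (s : ℝ) ^ β * η ^ 2 := by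
    intro s t hst
    have c1 : ∀ s t, covariance (fun ω => (inverseSubordinator D s ω : ℝ))
        (fun ω => compensatedClaims N X (η * rateSum lam) (inverseSubordinator D t ω) ω) μ = 0 := by
      intro s t
      rw [covariance_eq_sub (hW s) (hZ t), hZ0, mul_zero, sub_zero]
      exact hWZ s t
    have c2 : covariance
        (fun ω => compensatedClaims N X (η * rateSum lam) (inverseSubordinator D s ω) ω)
        (fun ω => compensatedClaims N X (η * rateSum lam) (inverseSubordinator D t ω) ω) μ
        = (variance (X 0) μ * rateSum lam + η ^ 2 * rateSqSum lam)
          * ((s : ℝ) ^ β / Real.Gamma (β + 1)) := by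
      rw [covariance_eq_sub (hZ s) (hZ t), hZ0, zero_mul, sub_zero,
        ← hD.integral_inverseSubordinator hβ0]
      exact hZZ s t hst
    -- Bilinear expansion: `c1` removes both mixed terms, and `c2` supplies the `S` and `T`
    -- contributions.
    rw [covariance_comm, gfrp_eq, gfrp_eq,
      covariance_const_add_left ((hcWZ s).integrable one_le_two),
      covariance_const_add_right ((hcWZ t).integrable one_le_two),
      covariance_fun_sub_fun_sub ((hW s).const_mul _) (hZ s) ((hW t).const_mul _) (hZ t),
      covariance_const_mul_left, covariance_const_mul_right, covariance_const_mul_left,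
      covariance_const_mul_right, c1, covariance_comm (fun ω => compensatedClaims _ _ _ _ _), c1, c2,
      gfcpS, gfcpT]
    ring
  refine ⟨fun t => ⟨hW t, hR t⟩, fun s t _ => hcov s t, fun t _ => ?_⟩
  rw [← covariance_self (hR t).aemeasurable, ← covariance_self (hW t).aemeasurable]
  exact hcov t t le_rfl
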